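/- Let $\mathcal I$ be a finite set of modes, and let $\Lambda=(\Lambda_{ij})_{i,j\in\mathcal I}$ be the generator of a continuous-time Markov process on $\mathcal I$ (off-diagonal entries are nonnegative, rows sum to $0$), with stationary distribution $\mathsf p$: $\mathsf p\Lambda=0$, $\mathsf p_i\ge 0$, $\sum_i\mathsf p_i=1$. (If $\Lambda$ is irreducible, $\mathsf p$ is unique; otherwise $\mathsf p$ may be any stationary distribution.) Let there be $n$ parallel servers, with saturation rates $u^i_k\ge 0$ for server $k$ in mode $i$, and let $\mathcal Q=\mathbb R_{\ge 0}^n$ be the set of vectors of queue lengths. A control policy $\phi:\mathcal I\times\mathcal Q\to\mathbb R_{\ge 0}^n$ is *admissible* for the total demand $A\ge 0$ if it is Borel measurable in $q$, $\sum_{k=1}^n\phi_k(i,q)=A$ for all $(i,q)$, and $\phi_k(i,q)$ is non-increasing in $q_k$ and non-decreasing in $q_h$ for every $h\ne k$. The discharge rate of server $k$ is $r^\phi_k(i,q)=u^i_k$ if $q_k>0$, and $r^\phi_k(i,q)=\min\{u^i_k,\phi_k(i,q)\}$ if $q_k=0$. The controlled piecewise-deterministic queueing (PDQ) system is the process $(I(t),Q(t))_{t\ge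 0}$ such that, from each initial condition $(i,q)\in\mathcal I\times\mathcal Q$, $I$ is the right-continuous Markov jump process with generator $\Lambda$ started at $i$, and almost surely $Q$ is continuous and $$Q_k(t)=q_k+\int_0^t\bigl(\phi_k(I(s),Q(s))-r^\phi_k(I(s),Q(s))\bigr)\,ds,\qquad t\ge 0,\ k=1,\dots,n.$$ Let $P_t((i,q);\cdot)$ denote the law of $(I(t),Q(t))$ from the initial condition $(i,q)$. The system is *stable* if there is a probability measure $\mu$ on $\mathcal I\times\mathcal Q$ with $\lim_{t\to\infty}\|P_t((i,q);\cdot)-\mu\|_{\mathrm{TV}}=0$ for every $(i,q)\in\mathcal I\times\mathcal Q$. **Theorem.** Suppose that a PDQ system with $n$ parallel servers is subject to a total demand $A\in\mathbb R_{\ge 0}$ and is controlled by an admissible policy $\phi$. If the PDQ system is stable, then the limits $\varphi^i_{kk}=\lim_{x\to\infty}\phi_k(i,x\,\mathbf e_k)$ exist, where $\mathbf e_k$ is the $k$-th unit vector, and $$\sum_{i\in\mathcal I}\mathsf p_i\,\varphi^i_{kk}\le\sum_{i\in\mathcal I}\mathsf p_i\,u^i_k\qquad\text{for every } k\in\{1,\dots,n\}.$$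 -/

import Mathlib

open MeasureTheory Filter Topology
open scoped NNReal

/-- `Λ` is the generator (transition rate matrix) of a Markov process on the finite set `ι`:
the off-diagonal entries are the transition rates and each row sums to zero. -/
structure IsRateMatrix {ι : Type*} [Fintype ι] (Λ : Matrix ι ι ℝ) : Prop where
  rate_nonneg : ∀ i j, i ≠ j → 0 ≤ Λ i j
  row_sum : ∀ i, ∑ j, Λ i j = 0

/-- `p` is a stationary probability distribution of the Markov process with generator `Λ`:
`p Λ = 0`, `p ≥ 0`, `∑ i, p i = 1`. -/
structure IsStationaryDistribution {ι : Type*} [Fintype ι] (Λ : Matrix ι ι ℝ) (p : ι → ℝ) :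
    Prop where
  nonneg : ∀ i, 0 ≤ p i
  sum_eq_one : ∑ i, p i = 1
  stationary : Matrix.vecMul p Λ = 0

/-- Under `P`, the process `I` (only times `t ≥ 0` matter) is the Markov jump process with
generator `Λ` started at `i₀`: its finite-dimensional distributions are those of the Markov
process with transition function `t ↦ exp (t Λ)`, and almost surely its path is
right-continuous with left limits for the discrete topology on the finite state space. -/
structure IsMarkovJumpProcess {ι : Type*} [Fintype ι] [DecidableEq ι] [MeasurableSpace ι]
    {Ω : Type*} [MeasurableSpace Ω] (Λ : Matrix ι ι ℝ) (P : Measure Ω) (I : ℝ → Ω → ι)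
    (i₀ : ι) : Prop where
  measurable : ∀ t, 0 ≤ t → Measurable (I t)
  fdd : ∀ (N : ℕ) (t : ℕ → ℝ) (j : ℕ → ι), t 0 = 0 → Monotone t →
    P.real {ω | ∀ l ≤ N, I (t l) ω = j l} =
      (if j 0 = i₀ then 1 else 0) *
        ∏ l ∈ Finset.range N, NormedSpace.exp ((t (l + 1) - t l) • Λ) (j l) (j (l + 1))
  right_continuous : ∀ᵐ ω ∂P, ∀ t, 0 ≤ t → ∀ᶠ s in 𝓝[>] t, I s ω = I t ω
  left_limits : ∀ᵐ ω ∂P, ∀ t, 0 < t → ∃ j, ∀ᶠ s in 𝓝[<] t, I s ω = j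

/-- `φ i q k` is the inflow sent to server `k` in mode `i` when the queue lengths are `q`.
The policy is admissible for the total demand `A` if the (nonnegative) inflows add up to `A`,
the inflow to a server is non-increasing in its own queue, and it is non-decreasing in the queue
of every other server. Of the regularity in `q`, only Borel measurability is required. -/
structure IsAdmissiblePolicy {ι : Type*} {n : ℕ} (A : ℝ≥0)
    (φ : ι → (Fin n → ℝ≥0) → Fin n → ℝ≥0) : Prop where
  measurable : ∀ i, Measurable (φ i)
  sum_eq : ∀ i q, ∑ k, φ i q k = A
  antitone_self : ∀ i q k, Antitone fun x : ℝ≥0 => φ i (Function.update q k x) k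
  monotone_other : ∀ i q k h, h ≠ k → Monotone fun x : ℝ≥0 => φ i (Function.update q h x) k

/-- The discharge rate of server `k` in mode `i` at queue lengths `q`: the saturation rate if
there is a queue, the smaller of the saturation rate and the inflow if there is none. -/
noncomputable def dischargeRate {ι : Type*} {n : ℕ} (u : ι → Fin n → ℝ≥0)
    (φ : ι → (Fin n → ℝ≥0) → Fin n → ℝ≥0) (i : ι) (q : Fin n → ℝ≥0) (k : Fin n) : ℝ≥0 :=
  if q k = 0 then min (u i k) (φ i q k) else u i k

/-- `(I, Q)` under the probability measures `P x`, for each initial condition `x = (i, q)`, is the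
piecewise-deterministic queueing process with mode generator `Λ`, saturation rates `u` and
control policy `φ`: the mode is the Markov jump process with generator `Λ` started at `i`, and
almost surely the queue lengths start at `q`, are continuous in time, and grow at the rate
inflow minus discharge rate (only times `t ≥ 0` matter). -/
structure IsPDQProcess {ι : Type*} [Fintype ι] [DecidableEq ι] [MeasurableSpace ι] {n : ℕ}
    {Ω : Type*} [MeasurableSpace Ω] (Λ : Matrix ι ι ℝ) (u : ι → Fin n → ℝ≥0)
    (φ : ι → (Fin n → ℝ≥0) → Fin n → ℝ≥0) (P : ι × (Fin n → ℝ≥0) → Measure Ω)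
    (I : ℝ → Ω → ι) (Q : ℝ → Ω → Fin n → ℝ≥0) : Prop where
  isProbabilityMeasure : ∀ x, IsProbabilityMeasure (P x)
  mode : ∀ x, IsMarkovJumpProcess Λ (P x) I x.1
  measurable_queue : ∀ t, 0 ≤ t → Measurable (Q t)
  continuous_queue : ∀ x, ∀ᵐ ω ∂(P x), ContinuousOn (fun t => Q t ω) (Set.Ici 0)
  queue_eq : ∀ x, ∀ᵐ ω ∂(P x), ∀ t, 0 ≤ t → ∀ k,
    (Q t ω k : ℝ) = x.2 k +
      ∫ s in (0 : ℝ)..t, ((φ (I s ω) (Q s ω) k : ℝ) - dischargeRate u φ (I s ω) (Q s ω) k)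

/-- Total variation distance of two probability measures,
`sup_B |μ B - ν B|` over the measurable sets `B`. -/
noncomputable def tvDistance {X : Type*} [MeasurableSpace X] (μ ν : Measure X) : ℝ :=
  ⨆ B : {B : Set X // MeasurableSet B}, |μ.real B - ν.real B|

/-- The transition probabilities `P_t(x; ·)`: the law at time `t` of the state `(I t, Q t)`,
from the initial condition `x`. -/
noncomputable def transitionLaw {ι : Type*} [MeasurableSpace ι] {n : ℕ}
    {Ω : Type*} [MeasurableSpace Ω] (P : ι × (Fin n → ℝ≥0) → Measure Ω)
    (I : ℝ → Ω → ι) (Q : ℝ → Ω → Fin n → ℝ≥0) (t : ℝ) (x : ι × (Fin n → ℝ≥0)) :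
    Measure (ι × (Fin n → ℝ≥0)) :=
  (P x).map fun ω => (I t ω, Q t ω)

/-- The queueing system is stable if there is a probability measure `μ` on the state space to
which the law of the state converges in total variation from every initial condition.
(Such a `μ` is unique.) -/
def IsStablePDQ {ι : Type*} [MeasurableSpace ι] {n : ℕ}
    {Ω : Type*} [MeasurableSpace Ω] (P : ι × (Fin n → ℝ≥0) → Measure Ω)
    (I : ℝ → Ω → ι) (Q : ℝ → Ω → Fin n → ℝ≥0) : Prop :=
  ∃ μ : Measure (ι × (Fin n → ℝ≥0)), IsProbabilityMeasure μ ∧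
    ∀ x, Tendsto (fun t => tvDistance (transitionLaw P I Q t x) μ) atTop (𝓝 0)

/-!
The inflow to server `k` is smallest when its own queue is long and all other queues are empty,
so it is at least the limit `ϕ i k` in mode `i`, whatever the queue lengths
(`IsAdmissiblePolicy.single_le`), while the discharge rate is at most `u i k`. Queue `k` therefore
grows over `[t, t + 1]` by at least the integral of `v = ϕ · k - u · k` along the mode process,
and by at most a constant `C` in absolute value (`queue_growth_bounds`).

Draw the initial mode from the stationary distribution `p` and let all queues start empty. The
mode is then distributed as `p` at all times (`IsStationaryDistribution.vecMul_exp`), so the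
integral has mean `∑ i, p i * v i` (`integral_integral_mode`); no uniqueness of `p` or ergodicity
is involved. By stability the law of the state still converges in total variation to some
probability measure `μ`.

The queue lengths need not have bounded means, so they are truncated at a level `M`. The mean of
the truncated queue converges, hence its increment over a unit of time tends to `0`. Truncation
changes an increment only if the queue exceeds `M - C`, and then by at most `2 C`. In the limit,
`∑ i, p i * v i` is at most `2 C` times the `μ`-probability that queue `k` exceeds `M - C`, and
this tends to `0` as `M → ∞` (`drift_nonpos`).
-/

/-! ### Total variation distance and expectations -/

lemma abs_measureReal_sub_le_tvDistance {X : Type*} [MeasurableSpace X] (μ ν : Measure X)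
    [IsProbabilityMeasure μ] [IsProbabilityMeasure ν] {B : Set X} (hB : MeasurableSet B) :
    |μ.real B - ν.real B| ≤ tvDistance μ ν := by
  refine le_ciSup (f := fun B : {B : Set X // MeasurableSet B} => |μ.real B - ν.real B|)
    ⟨1, ?_⟩ ⟨B, hB⟩
  rintro _ ⟨B, rfl⟩
  have hle (ρ : Measure X) [IsProbabilityMeasure ρ] : ρ.real B ≤ 1 := measureReal_le_one
  have hnonneg (ρ : Measure X) : 0 ≤ ρ.real B := measureReal_nonneg
  exact abs_sub_le_iff.2
    ⟨by linarith [hle μ, hnonneg ν], by linarith [hle ν, hnonneg μ]⟩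

/-- By the layer-cake formula, a function with values in `[0, M]` has expectations that differ by
at most `M` times the largest difference of the probabilities of a set. -/
lemma abs_integral_sub_integral_le {X : Type*} [MeasurableSpace X] (μ ν : Measure X)
    [IsProbabilityMeasure μ] [IsProbabilityMeasure ν] {ε M : ℝ} (hM : 0 ≤ M)
    (h : ∀ B, MeasurableSet B → |μ.real B - ν.real B| ≤ ε)
    {g : X → ℝ} (hg : Measurable g) (hg0 : ∀ x, 0 ≤ g x) (hgM : ∀ x, g x ≤ M) :
    |∫ x, g x ∂μ - ∫ x, g x ∂ν| ≤ ε * M := by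
  have hint (ρ : Measure X) [IsProbabilityMeasure ρ] : Integrable g ρ :=
    .of_bound hg.aestronglyMeasurable M
      (.of_forall fun x => by rw [Real.norm_of_nonneg (hg0 x)]; exact hgM x)
  have hlayer (ρ : Measure X) [IsProbabilityMeasure ρ] :
      IntegrableOn (fun y => ρ.real {a | y ≤ g a}) (Set.Ioc 0 M) := by
    have hanti : Antitone fun y => ρ.real {a | y ≤ g a} :=
      fun y z hyz => measureReal_mono fun a (ha : z ≤ g a) => hyz.trans ha
    refine Integrable.of_bound hanti.measurable.aestronglyMeasurable 1 (.of_forall fun y => ?_)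
    rw [Real.norm_of_nonneg measureReal_nonneg]
    exact measureReal_le_one
  rw [(hint μ).integral_eq_integral_Ioc_meas_le (.of_forall hg0) (.of_forall hgM),
    (hint ν).integral_eq_integral_Ioc_meas_le (.of_forall hg0) (.of_forall hgM),
    ← integral_sub (hlayer μ) (hlayer ν), ← Real.norm_eq_abs]
  refine (norm_setIntegral_le_of_norm_le_const (C := ε) (by simp)
    fun y _ => h _ (measurableSet_le measurable_const hg)).trans_eq ?_
  simp [hM]

/-! ### Markov jump processes on a finite set -/

/-- A stationary distribution is invariant under the transition matrices `exp (t Λ)`. -/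
lemma IsStationaryDistribution.vecMul_exp {ι : Type*} [Fintype ι] [DecidableEq ι]
    {Λ : Matrix ι ι ℝ} {p : ι → ℝ} (hp : IsStationaryDistribution Λ p) (t : ℝ) :
    Matrix.vecMul p (NormedSpace.exp (t • Λ)) = p := by
  let _ : NormedRing (Matrix ι ι ℝ) := Matrix.linftyOpNormedRing
  let _ : NormedAlgebra ℝ (Matrix ι ι ℝ) := Matrix.linftyOpNormedAlgebra
  have hexp := NormedSpace.exp_series_hasSum_exp' (𝕂 := ℝ) (t • Λ)
  have hcont : Continuous fun X : Matrix ι ι ℝ => Matrix.vecMul p X :=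
    continuous_const.matrix_vecMul continuous_id
  have hmap := hexp.map
    (AddMonoidHom.mk' (fun X : Matrix ι ι ℝ => Matrix.vecMul p X) fun X Y => Matrix.vecMul_add X Y p)
    hcont
  -- All terms of the exponential series but the zeroth are killed by `p Λ = 0`.
  have hsingle := hasSum_single
    (f := fun m : ℕ => Matrix.vecMul p (((m.factorial : ℝ))⁻¹ • (t • Λ) ^ m)) 0 fun m hm => by
      obtain ⟨m, rfl⟩ := Nat.exists_eq_succ_of_ne_zero hm
      simp [pow_succ', Matrix.vecMul_smul, ← Matrix.vecMul_vecMul, hp.stationary]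
  exact (hmap.unique hsingle).trans (by simp)

lemma IsMarkovJumpProcess.measureReal_eq {ι : Type*} [Fintype ι] [DecidableEq ι]
    [MeasurableSpace ι] {Ω : Type*} [MeasurableSpace Ω] {Λ : Matrix ι ι ℝ} {P : Measure Ω}
    [IsProbabilityMeasure P] [MeasurableSingletonClass ι] {I : ℝ → Ω → ι} {i₀ : ι}
    (h : IsMarkovJumpProcess Λ P I i₀) {t : ℝ} (ht : 0 ≤ t) (j : ι) :
    P.real {ω | I t ω = j} = NormedSpace.exp (t • Λ) i₀ j := by
  have h0 : P.real {ω | I 0 ω = i₀} = 1 := by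
    simpa using h.fdd 0 (fun _ => 0) (fun _ => i₀) rfl monotone_const
  have h1 := h.fdd 1 (fun l => if l = 0 then 0 else t) (fun l => if l = 0 then i₀ else j) rfl
    (monotone_nat_of_le_succ fun l => by rcases l with _ | l <;> simp [ht])
  have hset : {ω | ∀ l ≤ 1, I (if l = 0 then 0 else t) ω = if l = 0 then i₀ else j} =
      {ω | I 0 ω = i₀} ∩ {ω | I t ω = j} := by
    ext ω
    simp [Nat.le_one_iff_eq_zero_or_eq_one, or_imp, forall_and]
  have hae : ∀ᵐ ω ∂P, I 0 ω = i₀ :=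
    (prob_compl_eq_zero_iff (h.measurable 0 le_rfl (measurableSet_singleton i₀))).2
      ((ENNReal.toReal_eq_one_iff _).1 h0)
  rw [hset] at h1
  have h2 : P.real ({ω | I 0 ω = i₀} ∩ {ω | I t ω = j}) = P.real {ω | I t ω = j} := by
    refine measureReal_congr ?_
    filter_upwards [hae] with ω hω
    exact propext ⟨fun h => h.2, fun h => ⟨hω, h⟩⟩
  rw [← h2, h1]
  simp

/-- A right-continuous jump process on a finite set is jointly measurable in the outcome and the
time, up to null sets. -/
lemma aemeasurable_uncurry_of_rightContinuous {ι : Type*} [Finite ι] [MeasurableSpace ι]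
    [MeasurableSingletonClass ι] {Ω : Type*} [MeasurableSpace Ω] {P : Measure Ω}
    [IsProbabilityMeasure P] {I : ℝ → Ω → ι} (hI : ∀ t, 0 ≤ t → Measurable (I t))
    (hright : ∀ᵐ ω ∂P, ∀ t, 0 ≤ t → ∀ᶠ s in 𝓝[>] t, I s ω = I t ω) :
    AEMeasurable (fun z : Ω × ℝ => I z.2 z.1) (P.prod (volume.restrict (Set.Ici 0))) := by
  let _ : TopologicalSpace ι := ⊥
  have _ : DiscreteTopology ι := ⟨rfl⟩
  -- Evaluate `I` at the next point of the grid of mesh `1 / (N + 1)`, strictly to the right.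
  refine aemeasurable_of_tendsto_metrizable_ae atTop
    (f := fun (N : ℕ) (z : Ω × ℝ) => I (((⌊((N : ℝ) + 1) * z.2⌋₊ : ℝ) + 1) / (N + 1)) z.1)
    (fun N => Measurable.aemeasurable ?_) ?_
  · have h1 : Measurable fun z : Ω × ℕ => I (((z.2 : ℝ) + 1) / (N + 1)) z.1 :=
      measurable_from_prod_countable_left fun m =>
        hI (((m : ℝ) + 1) / (N + 1)) (by positivity)
    exact h1.comp (measurable_fst.prodMk
      (Nat.measurable_floor.comp (measurable_snd.const_mul _)))
  · have h1 := Measure.quasiMeasurePreserving_fst (μ := P)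
      (ν := volume.restrict (Set.Ici (0 : ℝ))) |>.ae hright
    have h2 := Measure.quasiMeasurePreserving_snd (μ := P)
      (ν := volume.restrict (Set.Ici (0 : ℝ))) |>.ae (ae_restrict_mem measurableSet_Ici)
    filter_upwards [h1, h2] with z hz (hz0 : 0 ≤ z.2)
    have hlt (N : ℕ) : z.2 < ((⌊((N : ℝ) + 1) * z.2⌋₊ : ℝ) + 1) / (N + 1) := by
      rw [lt_div_iff₀ (by positivity), mul_comm]
      exact Nat.lt_floor_add_one _
    have hle (N : ℕ) : ((⌊((N : ℝ) + 1) * z.2⌋₊ : ℝ) + 1) / (N + 1) ≤ z.2 + 1 / (N + 1) := by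
      have h := Nat.floor_le (show 0 ≤ ((N : ℝ) + 1) * z.2 by positivity)
      rw [div_le_iff₀ (by positivity)]
      field_simp
      linarith
    have hgrid : Tendsto (fun N : ℕ => ((⌊((N : ℝ) + 1) * z.2⌋₊ : ℝ) + 1) / (N + 1)) atTop
        (𝓝[>] z.2) := by
      refine tendsto_nhdsWithin_iff.2 ⟨?_, .of_forall hlt⟩
      refine tendsto_of_tendsto_of_tendsto_of_le_of_le tendsto_const_nhds ?_
        (fun N => (hlt N).le) hle
      simpa using tendsto_const_nhds.add (tendsto_one_div_add_atTop_nhds_zero_nat (𝕜 := ℝ))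
    exact tendsto_nhds_of_eventually_eq (hgrid.eventually (hz z.2 hz0))

/-- The accumulated value of `v` over a unit of time, when the mode is distributed as `p` at all
times. -/
lemma integral_integral_mode {ι : Type*} [Fintype ι] [MeasurableSpace ι]
    [MeasurableSingletonClass ι] {Ω : Type*} [MeasurableSpace Ω] {P : Measure Ω}
    [IsProbabilityMeasure P] {I : ℝ → Ω → ι} {p : ι → ℝ} (v : ι → ℝ)
    (hI : ∀ t, 0 ≤ t → Measurable (I t))
    (hjoint : AEMeasurable (fun z : Ω × ℝ => I z.2 z.1) (P.prod (volume.restrict (Set.Ici 0))))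
    (hlaw : ∀ t, 0 ≤ t → ∀ j, P.real {ω | I t ω = j} = p j) {t : ℝ} (ht : 0 ≤ t) :
    Integrable (fun ω => ∫ s in t..t + 1, v (I s ω)) P ∧
      ∫ ω, (∫ s in t..t + 1, v (I s ω)) ∂P = ∑ j, p j * v j := by
  have hint : Integrable (Function.uncurry fun ω s => v (I s ω))
      (P.prod (volume.restrict (Set.Ioc t (t + 1)))) := by
    obtain ⟨D, hD⟩ := (Set.finite_range fun j => ‖v j‖).bddAbove
    refine Integrable.of_bound ?_ D (.of_forall fun z => hD ⟨I z.2 z.1, rfl⟩)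
    refine ((measurable_of_countable v).comp_aemeasurable
      (hjoint.mono_measure ?_)).aestronglyMeasurable
    exact Measure.prod_mono le_rfl
      (Measure.restrict_mono (fun s hs => ht.trans hs.1.le) le_rfl)
  simp only [intervalIntegral.integral_of_le (show t ≤ t + 1 by linarith)]
  refine ⟨hint.integral_prod_left, ?_⟩
  rw [integral_integral_swap hint, setIntegral_congr_fun (g := fun _ => ∑ j, p j * v j)
    measurableSet_Ioc fun s hs => ?_]
  · simp
  have hs0 : 0 ≤ s := ht.trans hs.1.le
  have := Measure.isProbabilityMeasure_map (μ := P) (hI s hs0).aemeasurable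
  calc ∫ ω, v (I s ω) ∂P = ∫ j, v j ∂(P.map (I s)) :=
        (integral_map (hI s hs0).aemeasurable
          (measurable_of_countable v).aestronglyMeasurable).symm
    _ = ∑ j, p j * v j := by
        rw [integral_fintype .of_finite]
        refine Finset.sum_congr rfl fun j _ => ?_
        rw [map_measureReal_apply (hI s hs0) (measurableSet_singleton j), smul_eq_mul]
        exact congrArg (· * v j) (hlaw s hs0 j)

/-! ### Growth of a queue under an admissible policy -/

/-- The inflow to server `k` is smallest when the queues of all other servers are empty. -/
lemma IsAdmissiblePolicy.single_le {ι : Type*} {n : ℕ} {A : ℝ≥0}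
    {φ : ι → (Fin n → ℝ≥0) → Fin n → ℝ≥0} (hφ : IsAdmissiblePolicy A φ)
    (i : ι) (q : Fin n → ℝ≥0) (k : Fin n) : φ i (Pi.single k (q k)) k ≤ φ i q k := by
  have key : ∀ s : Finset (Fin n), k ∉ s → φ i (s.piecewise 0 q) k ≤ φ i q k := by
    intro s
    induction s using Finset.induction_on with
    | empty => simp
    | insert j s _ ih =>
      intro hk
      rw [Finset.mem_insert, not_or] at hk
      refine le_trans ?_ (ih hk.2)
      rw [Finset.piecewise_insert]
      simpa using hφ.monotone_other i (s.piecewise 0 q) k j (Ne.symm hk.1)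
        (zero_le : 0 ≤ s.piecewise 0 q j)
  convert key (Finset.univ.erase k) (by simp) using 2
  ext j
  by_cases hj : j = k
  · subst hj; simp
  · simp [hj]

lemma IsAdmissiblePolicy.antitone_single {ι : Type*} {n : ℕ} {A : ℝ≥0}
    {φ : ι → (Fin n → ℝ≥0) → Fin n → ℝ≥0} (hφ : IsAdmissiblePolicy A φ)
    (i : ι) (k : Fin n) : Antitone fun x : ℝ≥0 => φ i (Pi.single k x) k :=
  hφ.antitone_self i 0 k

lemma IsAdmissiblePolicy.le_demand {ι : Type*} {n : ℕ} {A : ℝ≥0}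
    {φ : ι → (Fin n → ℝ≥0) → Fin n → ℝ≥0} (hφ : IsAdmissiblePolicy A φ)
    (i : ι) (q : Fin n → ℝ≥0) (k : Fin n) : φ i q k ≤ A :=
  (Finset.single_le_sum (fun _ _ => zero_le) (Finset.mem_univ k)).trans_eq (hφ.sum_eq i q)

lemma dischargeRate_le {ι : Type*} {n : ℕ} (u : ι → Fin n → ℝ≥0)
    (φ : ι → (Fin n → ℝ≥0) → Fin n → ℝ≥0) (i : ι) (q : Fin n → ℝ≥0) (k : Fin n) :
    dischargeRate u φ i q k ≤ u i k := by
  unfold dischargeRate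
  split_ifs
  · exact min_le_left _ _
  · exact le_rfl

lemma measurable_dischargeRate {ι : Type*} {n : ℕ} (u : ι → Fin n → ℝ≥0) {A : ℝ≥0}
    {φ : ι → (Fin n → ℝ≥0) → Fin n → ℝ≥0} (hφ : IsAdmissiblePolicy A φ) (i : ι) (k : Fin n) :
    Measurable fun q => dischargeRate u φ i q k := by
  unfold dischargeRate
  exact Measurable.ite (measurable_pi_apply k (measurableSet_singleton 0))
    (measurable_const.min ((measurable_pi_apply k).comp (hφ.measurable i))) measurable_const

/-- Pathwise bounds on the growth of a queue, for a mode path and a queue path that solve the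
queueing equation: it is at least the accumulated excess `v` of the guaranteed inflow over the
saturation rate, and the queue is Lipschitz. -/
lemma queue_growth_bounds {ι : Type*} [Finite ι] [MeasurableSpace ι] [MeasurableSingletonClass ι]
    {n : ℕ} {u : ι → Fin n → ℝ≥0} {A : ℝ≥0} {φ : ι → (Fin n → ℝ≥0) → Fin n → ℝ≥0}
    (hφ : IsAdmissiblePolicy A φ) {i : ℝ → ι} {q : ℝ → Fin n → ℝ≥0} {k : Fin n} {q₀ C : ℝ}
    {v : ι → ℝ} (hv : ∀ j x, v j ≤ φ j x k - u j k) (hC : ∀ j, (A : ℝ) + u j k ≤ C)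
    (hi : AEMeasurable i (volume.restrict (Set.Ici 0))) (hq : ContinuousOn q (Set.Ici 0))
    (heq : ∀ t, 0 ≤ t → (q t k : ℝ) = q₀ +
      ∫ s in (0 : ℝ)..t, ((φ (i s) (q s) k : ℝ) - dischargeRate u φ (i s) (q s) k))
    {t : ℝ} (ht : 0 ≤ t) :
    ∫ s in t..t + 1, v (i s) ≤ q (t + 1) k - q t k ∧ |(q (t + 1) k : ℝ) - q t k| ≤ C := by
  set F : ι × (Fin n → ℝ≥0) → ℝ := fun z => (φ z.1 z.2 k : ℝ) - dischargeRate u φ z.1 z.2 k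
    with hF
  have hFle (z) : |F z| ≤ C := by
    have h1 : (φ z.1 z.2 k : ℝ) ≤ A := by exact_mod_cast hφ.le_demand z.1 z.2 k
    have h2 : (dischargeRate u φ z.1 z.2 k : ℝ) ≤ u z.1 k := by
      exact_mod_cast dischargeRate_le u φ z.1 z.2 k
    have := hC z.1
    have h3 := (φ z.1 z.2 k).coe_nonneg
    have h4 := (dischargeRate u φ z.1 z.2 k).coe_nonneg
    have h5 := (u z.1 k).coe_nonneg
    have h6 := A.coe_nonneg
    exact abs_le.2 ⟨by simp only [hF]; linarith, by simp only [hF]; linarith⟩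
  have hvF (z) : v z.1 ≤ F z := by
    have h2 : (dischargeRate u φ z.1 z.2 k : ℝ) ≤ u z.1 k := by
      exact_mod_cast dischargeRate_le u φ z.1 z.2 k
    have := hv z.1 z.2
    simp only [hF]
    linarith
  have hFm : Measurable F := measurable_from_prod_countable_right fun j =>
    (measurable_coe_nnreal_real.comp ((measurable_pi_apply k).comp (hφ.measurable j))).sub
      (measurable_coe_nnreal_real.comp (measurable_dischargeRate u hφ j k))
  have hrestrict {a b : ℝ} (ha : 0 ≤ a) :
      volume.restrict (Set.Ioc a b) ≤ volume.restrict (Set.Ici (0 : ℝ)) :=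
    Measure.restrict_mono (fun s hs => ha.trans hs.1.le) le_rfl
  have hFint {a b : ℝ} (ha : 0 ≤ a) (hab : a ≤ b) :
      IntervalIntegrable (fun s => F (i s, q s)) volume a b := by
    rw [intervalIntegrable_iff_integrableOn_Ioc_of_le hab]
    refine Integrable.of_bound ?_ C (.of_forall fun s => hFle _)
    exact ((hFm.comp_aemeasurable (hi.prodMk (hq.aemeasurable measurableSet_Ici))).mono_measure
      (hrestrict ha)).aestronglyMeasurable
  have hvint : IntervalIntegrable (fun s => v (i s)) volume t (t + 1) := by
    obtain ⟨D, hD⟩ := (Set.finite_range fun j => ‖v j‖).bddAbove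
    rw [intervalIntegrable_iff_integrableOn_Ioc_of_le (by linarith)]
    refine Integrable.of_bound ?_ D (.of_forall fun s => hD ⟨i s, rfl⟩)
    exact ((measurable_of_countable v).comp_aemeasurable
      (hi.mono_measure (hrestrict ht))).aestronglyMeasurable
  have hdiff : (q (t + 1) k : ℝ) - q t k = ∫ s in t..t + 1, F (i s, q s) := by
    rw [heq t ht, heq (t + 1) (by linarith),
      ← intervalIntegral.integral_add_adjacent_intervals (hFint le_rfl ht)
        (hFint ht (by linarith : t ≤ t + 1))]
    ring
  rw [hdiff]
  refine ⟨intervalIntegral.integral_mono_on (by linarith) hvint (hFint ht (by linarith))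
    fun s _ => hvF (i s, q s), ?_⟩
  simpa using intervalIntegral.norm_integral_le_of_norm_le_const (a := t) (b := t + 1)
    (f := fun s => F (i s, q s)) fun s _ => hFle _

/-! ### Drift of a process that converges in total variation -/

/-- Truncating at level `M` does not affect an increment of size at most `C` that starts below
`M - C`, and can only change an increment by `2 C` otherwise. -/
lemma sub_indicator_le_min_sub_min {a b C M : ℝ} (h : |b - a| ≤ C) :
    b - a - (if M < a + C then 2 * C else 0) ≤ min b M - min a M := by
  obtain ⟨h1, h2⟩ := abs_le.1 h
  split_ifs with hM
  · rcases min_cases b M with ⟨h3, _⟩ | ⟨h3, _⟩ <;> rcases min_cases a M with ⟨h4, _⟩ | ⟨h4, _⟩ <;>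
      linarith
  · rw [min_eq_left (by linarith), min_eq_left (by linarith)]
    linarith

lemma tendsto_measureReal_lt_atTop_zero {X : Type*} [MeasurableSpace X] (μ : Measure X)
    [IsProbabilityMeasure μ] {g : X → ℝ} (hg : Measurable g) :
    Tendsto (fun m : ℕ => μ.real {x | (m : ℝ) < g x}) atTop (𝓝 0) := by
  have hanti : Antitone fun m : ℕ => {x | (m : ℝ) < g x} :=
    fun a b hab x (hx : (b : ℝ) < g x) => lt_of_le_of_lt (Nat.cast_le.2 hab) hx
  have h := tendsto_measure_iInter_atTop (μ := μ)
    (fun m : ℕ => (measurableSet_lt measurable_const hg).nullMeasurableSet) hanti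
    ⟨0, measure_ne_top _ _⟩
  have hempty : ⋂ m : ℕ, {x | (m : ℝ) < g x} = ∅ := by
    refine Set.eq_empty_of_forall_notMem fun x hx => ?_
    obtain ⟨m, hm⟩ := exists_nat_ge (g x)
    exact absurd (Set.mem_iInter.1 hx m) (not_lt.2 hm)
  rw [hempty, measure_empty] at h
  exact (ENNReal.tendsto_toReal ENNReal.zero_ne_top).comp h

/-- A process whose law converges in total variation cannot drift to infinity: if its increments
over a unit of time are bounded and dominate random variables of mean `c`, then `c ≤ 0`. -/
lemma drift_nonpos {Ω X : Type*} [MeasurableSpace Ω] [MeasurableSpace X] {P : Measure Ω}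
    [IsProbabilityMeasure P] {μ : Measure X} [IsProbabilityMeasure μ] {Z : ℝ → Ω → X}
    (hZ : ∀ t, 0 ≤ t → Measurable (Z t)) {ε : ℝ → ℝ} (hε : Tendsto ε atTop (𝓝 0))
    (hconv : ∀ t, 0 ≤ t → ∀ B, MeasurableSet B → |(P.map (Z t)).real B - μ.real B| ≤ ε t)
    {g : X → ℝ} (hg : Measurable g) (hg0 : ∀ x, 0 ≤ g x) {Y : ℝ → Ω → ℝ} {c C : ℝ}
    (hY : ∀ t, 0 ≤ t → Integrable (Y t) P) (hYc : ∀ t, 0 ≤ t → ∫ ω, Y t ω ∂P = c)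
    (hinc : ∀ᵐ ω ∂P, ∀ t, 0 ≤ t →
      Y t ω ≤ g (Z (t + 1) ω) - g (Z t ω) ∧ |g (Z (t + 1) ω) - g (Z t ω)| ≤ C) :
    c ≤ 0 := by
  have hmapprob (t : ℝ) (ht : 0 ≤ t) : IsProbabilityMeasure (P.map (Z t)) :=
    Measure.isProbabilityMeasure_map (hZ t ht).aemeasurable
  have htail (M : ℕ) : c ≤ 2 * C * μ.real {x | (M : ℝ) < g x + C} := by
    have hM : (0 : ℝ) ≤ M := M.cast_nonneg
    have hBm : MeasurableSet {x | (M : ℝ) < g x + C} :=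
      measurableSet_lt measurable_const (hg.add_const C)
    have hgM : Measurable fun x => min (g x) (M : ℝ) := hg.min measurable_const
    have htrunc (t : ℝ) (ht : 0 ≤ t) :
        |∫ ω, min (g (Z t ω)) (M : ℝ) ∂P - ∫ x, min (g x) (M : ℝ) ∂μ| ≤ ε t * M := by
      have := hmapprob t ht
      have h := abs_integral_sub_integral_le _ μ hM (hconv t ht) hgM
        (fun x => le_min (hg0 x) hM) fun x => min_le_right _ _
      rwa [integral_map (hZ t ht).aemeasurable hgM.aestronglyMeasurable] at h
    have hstep (t : ℝ) (ht : 0 ≤ t) :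
        c - 2 * C * (P.map (Z t)).real {x | (M : ℝ) < g x + C} ≤ ε (t + 1) * M + ε t * M := by
      have ht1 : 0 ≤ t + 1 := by linarith
      have hint (s : ℝ) (hs : 0 ≤ s) : Integrable (fun ω => min (g (Z s ω)) (M : ℝ)) P := by
        refine .of_bound (hgM.comp (hZ s hs)).aestronglyMeasurable M (.of_forall fun ω => ?_)
        rw [Real.norm_of_nonneg (le_min (hg0 _) hM)]
        exact min_le_right _ _
      have hset : MeasurableSet (Z t ⁻¹' {x | (M : ℝ) < g x + C}) := hZ t ht hBm
      have hind : Integrable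
          ((Z t ⁻¹' {x | (M : ℝ) < g x + C}).indicator fun _ => 2 * C) P :=
        (integrable_const _).indicator hset
      have hmono : ∫ ω, (Y t ω -
            (Z t ⁻¹' {x | (M : ℝ) < g x + C}).indicator (fun _ => 2 * C) ω) ∂P ≤
          ∫ ω, (min (g (Z (t + 1) ω)) (M : ℝ) - min (g (Z t ω)) (M : ℝ)) ∂P := by
        refine integral_mono_ae ((hY t ht).sub hind) ((hint _ ht1).sub (hint _ ht)) ?_
        filter_upwards [hinc] with ω hω
        have h1 := sub_indicator_le_min_sub_min (M := M) (hω t ht).2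
        have h2 := (hω t ht).1
        have h3 : (Z t ⁻¹' {x | (M : ℝ) < g x + C}).indicator (fun _ => 2 * C) ω =
            if M < g (Z t ω) + C then 2 * C else 0 := rfl
        linarith
      rw [integral_sub (hY t ht) hind, hYc t ht, integral_indicator_const _ hset,
        integral_sub (hint _ ht1) (hint _ ht), smul_eq_mul] at hmono
      rw [map_measureReal_apply (hZ t ht) hBm]
      linarith [(abs_le.1 (htrunc t ht)).1, (abs_le.1 (htrunc (t + 1) ht1)).2]
    have hlim : Tendsto (fun t => (P.map (Z t)).real {x | (M : ℝ) < g x + C}) atTop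
        (𝓝 (μ.real {x | (M : ℝ) < g x + C})) := by
      rw [tendsto_iff_norm_sub_tendsto_zero]
      refine squeeze_zero' (.of_forall fun t => norm_nonneg _) ?_ hε
      filter_upwards [eventually_ge_atTop 0] with t ht
      exact hconv t ht _ hBm
    have hε1 : Tendsto (fun t => ε (t + 1)) atTop (𝓝 0) :=
      hε.comp (tendsto_atTop_add_const_right _ _ tendsto_id)
    have h := le_of_tendsto_of_tendsto (tendsto_const_nhds.sub (hlim.const_mul (2 * C)))
      ((hε1.mul_const (M : ℝ)).add (hε.mul_const (M : ℝ)))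
      ((eventually_ge_atTop 0).mono hstep)
    linarith
  have hzero := (tendsto_measureReal_lt_atTop_zero μ (hg.add_const C)).const_mul (2 * C)
  rw [mul_zero] at hzero
  exact ge_of_tendsto' hzero htail

/-! ### Random initial states -/

/-- The law of the outcome when the initial state is drawn at random, with weights `p i` for the
initial states `x i`. -/
noncomputable def mixtureMeasure {ι X Ω : Type*} [Fintype ι] [MeasurableSpace Ω] (p : ι → ℝ)
    (P : X → Measure Ω) (x : ι → X) : Measure Ω :=
  Measure.sum fun i => ENNReal.ofReal (p i) • P (x i)

section mixtureMeasure

variable {ι X Ω : Type*} [Fintype ι] [MeasurableSpace Ω] {p : ι → ℝ} {P : X → Measure Ω}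
  {x : ι → X}

lemma ae_mixtureMeasure {s : Ω → Prop} (h : ∀ i, ∀ᵐ ω ∂(P (x i)), s ω) :
    ∀ᵐ ω ∂(mixtureMeasure p P x), s ω := by
  rw [mixtureMeasure, Measure.ae_sum_iff]
  exact fun i => Measure.ae_smul_measure (h i) _

lemma mixtureMeasure_real_apply (hp : ∀ i, 0 ≤ p i) (hP : ∀ y, IsProbabilityMeasure (P y))
    (B : Set Ω) : (mixtureMeasure p P x).real B = ∑ i, p i * (P (x i)).real B := by
  rw [mixtureMeasure, Measure.sum_fintype, measureReal_def, Measure.finsetSum_apply,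
    ENNReal.toReal_sum fun i _ => ?_]
  · simp [measureReal_def, hp]
  · exact ENNReal.mul_ne_top ENNReal.ofReal_ne_top (measure_ne_top _ _)

lemma isProbabilityMeasure_mixtureMeasure (hp : ∀ i, 0 ≤ p i) (hsum : ∑ i, p i = 1)
    (hP : ∀ y, IsProbabilityMeasure (P y)) : IsProbabilityMeasure (mixtureMeasure p P x) := by
  refine ⟨?_⟩
  rw [mixtureMeasure, Measure.sum_fintype, Measure.finsetSum_apply]
  simp [← ENNReal.ofReal_sum_of_nonneg fun i _ => hp i, hsum]

end mixtureMeasure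

/-! ### Stability and the nominal load -/

theorem theorem1 {ι : Type*} [Fintype ι] [DecidableEq ι] [MeasurableSpace ι]
    [MeasurableSingletonClass ι] {n : ℕ} {Ω : Type*} [MeasurableSpace Ω]
    (Λ : Matrix ι ι ℝ) (hΛ : IsRateMatrix Λ)
    (p : ι → ℝ) (hp : IsStationaryDistribution Λ p)
    (u : ι → Fin n → ℝ≥0) (A : ℝ≥0)
    (φ : ι → (Fin n → ℝ≥0) → Fin n → ℝ≥0) (hφ : IsAdmissiblePolicy A φ)
    (P : ι × (Fin n → ℝ≥0) → Measure Ω) (I : ℝ → Ω → ι) (Q : ℝ → Ω → Fin n → ℝ≥0)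
    (hPDQ : IsPDQProcess Λ u φ P I Q) (hstable : IsStablePDQ P I Q) :
    ∃ ϕ : ι → Fin n → ℝ≥0,
      (∀ i k, Tendsto (fun x : ℝ≥0 => φ i (Pi.single k x) k) atTop (𝓝 (ϕ i k))) ∧
      ∀ k, ∑ i, p i * (ϕ i k : ℝ) ≤ ∑ i, p i * (u i k : ℝ) := by
  refine ⟨fun i k => ⨅ x : ℝ≥0, φ i (Pi.single k x) k, fun i k =>
    tendsto_atTop_ciInf (hφ.antitone_single i k) (OrderBot.bddBelow _), fun k => ?_⟩
  set v : ι → ℝ := fun i => ((⨅ x : ℝ≥0, φ i (Pi.single k x) k : ℝ≥0) : ℝ) - u i k with hv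
  have hvle (i : ι) (q : Fin n → ℝ≥0) : v i ≤ φ i q k - u i k := by
    have h : (⨅ x : ℝ≥0, φ i (Pi.single k x) k) ≤ φ i q k :=
      (ciInf_le (OrderBot.bddBelow _) (q k)).trans (hφ.single_le i q k)
    exact sub_le_sub_right (NNReal.coe_le_coe.2 h) _
  suffices h : ∑ i, p i * v i ≤ 0 by
    simp only [hv, mul_sub, Finset.sum_sub_distrib] at h
    linarith
  obtain ⟨μ, hμ, htv⟩ := hstable
  have hP := hPDQ.isProbabilityMeasure
  -- All queues are empty at time `0`, and the initial mode is drawn from `p`.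
  set x₀ : ι → ι × (Fin n → ℝ≥0) := fun i => (i, 0) with hx₀
  set ν := mixtureMeasure p P x₀ with hν
  have hνprob : IsProbabilityMeasure ν :=
    isProbabilityMeasure_mixtureMeasure hp.nonneg hp.sum_eq_one hP
  obtain ⟨i₀⟩ : Nonempty ι := by
    by_contra hempty
    rw [not_nonempty_iff] at hempty
    simpa using hp.sum_eq_one
  have hI : ∀ t, 0 ≤ t → Measurable (I t) := (hPDQ.mode (x₀ i₀)).measurable
  have hZ (t : ℝ) (ht : 0 ≤ t) : Measurable fun ω => (I t ω, Q t ω) :=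
    (hI t ht).prodMk (hPDQ.measurable_queue t ht)
  have hlaw (t : ℝ) (ht : 0 ≤ t) (j : ι) : ν.real {ω | I t ω = j} = p j := by
    rw [hν, mixtureMeasure_real_apply hp.nonneg hP]
    simp only [fun i => (hPDQ.mode (x₀ i)).measureReal_eq ht j]
    exact congrFun (hp.vecMul_exp t) j
  have hjoint := aemeasurable_uncurry_of_rightContinuous (P := ν) hI
    (ae_mixtureMeasure fun i => (hPDQ.mode (x₀ i)).right_continuous)
  have hpath : ∀ᵐ ω ∂ν, AEMeasurable (fun s => I s ω) (volume.restrict (Set.Ici 0)) := by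
    let _ : TopologicalSpace ι := ⊥
    have _ : DiscreteTopology ι := ⟨rfl⟩
    filter_upwards [hjoint.aestronglyMeasurable.prodMk_left] with ω hω
    exact hω.aemeasurable
  obtain ⟨C, hC⟩ := (Set.finite_range fun j => (A : ℝ) + u j k).bddAbove
  refine drift_nonpos hZ (ε := fun t => ∑ i, p i * tvDistance (transitionLaw P I Q t (x₀ i)) μ)
    ?_ (fun t ht B hB => ?_) (μ := μ) (g := fun z => (z.2 k : ℝ))
    (measurable_coe_nnreal_real.comp ((measurable_pi_apply k).comp measurable_snd))
    (fun z => (z.2 k).coe_nonneg)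
    (fun t ht => (integral_integral_mode v hI hjoint hlaw ht).1)
    (fun t ht => (integral_integral_mode v hI hjoint hlaw ht).2) (C := C) ?_
  · simpa using tendsto_finsetSum Finset.univ fun i _ => (htv (x₀ i)).const_mul (p i)
  · have hdiff : (ν.map fun ω => (I t ω, Q t ω)).real B - μ.real B =
        ∑ i, p i * ((transitionLaw P I Q t (x₀ i)).real B - μ.real B) := by
      rw [map_measureReal_apply (hZ t ht) hB, hν, mixtureMeasure_real_apply hp.nonneg hP]
      simp only [mul_sub, Finset.sum_sub_distrib, ← Finset.sum_mul, hp.sum_eq_one, one_mul,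
        transitionLaw, map_measureReal_apply (hZ t ht) hB]
    rw [hdiff]
    refine (Finset.abs_sum_le_sum_abs _ _).trans (Finset.sum_le_sum fun i _ => ?_)
    rw [abs_mul, abs_of_nonneg (hp.nonneg i)]
    have : IsProbabilityMeasure (transitionLaw P I Q t (x₀ i)) :=
      Measure.isProbabilityMeasure_map (hZ t ht).aemeasurable
    exact mul_le_mul_of_nonneg_left (abs_measureReal_sub_le_tvDistance _ _ hB) (hp.nonneg i)
  · have hcont : ∀ᵐ ω ∂ν, ContinuousOn (fun t => Q t ω) (Set.Ici 0) :=
      ae_mixtureMeasure fun i => hPDQ.continuous_queue (x₀ i)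
    have hqueue : ∀ᵐ ω ∂ν, ∀ t, 0 ≤ t → (Q t ω k : ℝ) = 0 + ∫ s in (0 : ℝ)..t,
        ((φ (I s ω) (Q s ω) k : ℝ) - dischargeRate u φ (I s ω) (Q s ω) k) := by
      refine ae_mixtureMeasure fun i => ?_
      filter_upwards [hPDQ.queue_eq (x₀ i)] with ω hω t ht
      simpa [hx₀] using hω t ht k
    filter_upwards [hpath, hcont, hqueue] with ω h1 h2 h3 t ht
    exact queue_growth_bounds hφ hvle (fun j => hC ⟨j, rfl⟩) h1 h2 h3 ht
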